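/- Let $p\ge 3$ be odd, let $q\in\mathbb C$ be a primitive $p$-th root of unity and fix a square root $q^{1/2}$ of $q$. Put $[n]=\frac{q^n-q^{-n}}{q-q^{-1}}$, $[n]!=[1][2]\cdots[n]$, $[0]!=1$. Let $A(E(1,1|p))$ be the unital complex $*$-algebra generated by self-adjoint elements $\eta_+,\eta_-,\delta$ with the relations $\eta_-\eta_+=q^2\eta_+\eta_-$, $\eta_\pm\delta=q^2\delta\eta_\pm$, $\delta^p=1$, $\eta_\pm^p=0$, and let $A(E_q(1,1))=A(E(1,1|p))\otimes C^\infty(\mathbb R^2)$, where $C^\infty(\mathbb R^2)$ is the $*$-algebra of complex-valued smooth functions of $(z_+,z_-)$. Let $A(SO(1,1|p))$ be the commutative $*$-algebra of polynomials in a self-adjoint element $\delta$ with $\delta^p=1$, with the Hermitian form $(a,b)_S=\mathcal I_S(a^*b)$, where $\mathcal I_S$ is linear, $\mathcal I_S(\delta^m)=1$ if $p\mid m$ and $\mathcal I_S(\delta^m)=0$ otherwise; put $\{a\otimes F,b\otimes G\}_S=(a,b)_S\,F^*G$ on $A(SO(1,1|p))\otimes A(E_q(1,1))$. Let $U_q(e(1,1))$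 be the algebra generated by $p_+,p_-,\kappa$ with the relations $p_+p_-=p_-p_+$, $p_\pm\kappa=q^{\mp1}\kappa p_\pm$, $\kappa^p=1$, and put $P_\pm=p_\pm^p$, $\epsilon_\pm=-q^{\mp1/2}p_\pm\kappa^{-1}$. For real $\lambda=(\lambda_+,\lambda_-)\ne(0,0)$ let $\mathcal L^\lambda$ be its representation on $A(SO(1,1|p))$ given by $\mathcal L^\lambda(p_\pm)\delta^m=\lambda_\pm\delta^{m\pm1}$, $\mathcal L^\lambda(\kappa)\delta^m=q^m\delta^m$. With the cut-off $q$-exponentials $e_\pm^x=\sum_{m=0}^{p-1}\frac{q^{\pm m(m-1)/2}}{[m]!}x^m$ and $D(\kappa,\delta)=\frac1p\sum_{m,k=0}^{p-1}q^{-mk}\kappa^m\otimes\delta^k$, the $p$-dimensional representation $T^\lambda:A(SO(1,1|p))\to A(SO(1,1|p))\otimes A(E_q(1,1))$ of $E_q(1,1)$ is $$T^\lambda a=e^{-i\mathcal L^\lambda(P_+)\otimes z_+-i\mathcal L^\lambda(P_-)\otimes z_-}\,e_+^{\,i\mathcal L^\lambda(\epsilon_+)\otimes\eta_+}\,e_-^{\,i\mathcal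 L^\lambda(\epsilon_-)\otimes\eta_-}\,D(\mathcal L^\lambda(\kappa),\delta)\,(a\otimes1),$$ and its matrix elements are $D^\lambda_{mn}=\{\delta^{p-m}\otimes1,\;T^\lambda\delta^n\}_S$ for $0\le m,n\le p-1$. Put $\xi=q\eta_+\eta_-$ and $\lambda^2=\lambda_+\lambda_-$; empty sums are $0$. Then for all $0\le m,n\le p-1$: if $n\ge m$, $$D^\lambda_{mn}=e^{-i\lambda_+^pz_+-i\lambda_-^pz_-}\Big[\sum_{k=0}^{p-1-n+m}\frac{(-\lambda^2)^kq^{-k(m+n)}}{[k]!\,[k+n-m]!}\,\xi^k\,\big(-iq^{\frac12-n}\lambda_-\eta_-\big)^{n-m}\delta^n+\big(-iq^{-\frac12-n}\lambda_+\eta_+\big)^{p+m-n}\delta^n\sum_{k=0}^{n-m-1}\frac{(-\lambda^2)^kq^{k(m+n)}}{[k]!\,[k+p+m-n]!}\,\xi^k\Big];$$ if $m\ge n$, $$D^\lambda_{mn}=e^{-i\lambda_+^pz_+-i\lambda_-^pz_-}\Big[\sum_{k=0}^{m-n-1}\frac{(-\lambda^2)^kq^{-k(m+n)}}{[k]!\,[k+p+n-m]!}\,\xi^k\,\big(-iq^{\frac12-n}\lambda_-\eta_-\big)^{p+n-m}\delta^n+\big(-iq^{-\frac12-n}\lambda_+\eta_+\big)^{m-n}\delta^n\sum_{k=0}^{p-1-m+n}\frac{(-\lambda^2)^kq^{k(m+n)}}{[k]!\,[k+m-n]!}\,\xi^k\Big].$$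 In particular, for $0\le m\le p-1$, $$D^\lambda_{m0}=e^{-i\lambda_+^pz_+-i\lambda_-^pz_-}\Big[\mathcal J_{p-m}(\lambda^2\xi)\big(-iq^{\frac12}\lambda_-\eta_-\big)^{p-m}+\big(-iq^{-\frac12}\lambda_+\eta_+\big)^m\mathcal J_m(\lambda^2\xi)\Big],$$ where $\mathcal J_m(x)=\sum_{k=0}^{p-1-m}\frac{(-1)^k}{[k]!\,[k+m]!}(q^mx)^k$ is the Hahn–Exton $q$-Bessel series $J_m(x)=\sum_{k\ge0}\frac{(-1)^k}{[k]!\,[k+m]!}(q^mx)^k$ cut off after the term $k=p-1-m$. -/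

import Mathlib

open scoped TensorProduct ContDiff

noncomputable section

namespace QPoincare

/-! ### `q`-numbers and cut-off `q`-functions -/

/-- The `q`-number `[n] = (q ^ n - q ^ (-n)) / (q - q ^ (-1))`. -/
def qNum (q : ℂ) (n : ℕ) : ℂ := (q ^ n - (q ^ n)⁻¹) / (q - q⁻¹)

/-- The `q`-factorial `[n]! = [1] [2] ⋯ [n]`. -/
def qFact (q : ℂ) (n : ℕ) : ℂ := ∏ j ∈ Finset.range n, qNum q (j + 1)

/-- The cut-off `q`-exponential
`e_σ ^ x = ∑_{m < p} q ^ (σ m (m - 1) / 2) / [m]! x ^ m`, for a sign `σ = 1` or `σ = -1`. -/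
def cutoffExp (p : ℕ) (q : ℂ) (σ : ℤ) {R : Type*} [Ring R] [Algebra ℂ R] (x : R) : R :=
  ∑ m ∈ Finset.range p, (q ^ (σ * (m.choose 2 : ℤ)) / qFact q m) • x ^ m

/-- The `k`-th coefficient `(-1) ^ k q ^ (m k) / ([k]! [k + m]!)` of the Hahn--Exton
`q`-Bessel function `J_m(x) = ∑_k (-1) ^ k / ([k]! [k + m]!) (q ^ m x) ^ k`. -/
def hahnExtonCoeff (q : ℂ) (m k : ℕ) : ℂ :=
  (-1) ^ k * (q ^ m) ^ k / (qFact q k * qFact q (k + m))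

/-- The cut-off Hahn--Exton `q`-Bessel function: the series `J_m(x)` cut off after the term
`k = p - 1 - m` (an empty sum for `m = p`). -/
def cutoffBessel (p : ℕ) (q : ℂ) (m : ℕ) {R : Type*} [Ring R] [Algebra ℂ R] (x : R) : R :=
  ∑ k ∈ Finset.range (p - m), hahnExtonCoeff q m k • x ^ k

/-! ### The conjugate-opposite algebra, an auxiliary device for defining involutions -/

/-- The opposite ring of `A`, with complex scalars acting through complex conjugation. -/
def ConjOp (A : Type) : Type := Aᵐᵒᵖ

namespace ConjOp

instance (A : Type) [Ring A] : Ring (ConjOp A) := inferInstanceAs (Ring Aᵐᵒᵖ)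

instance (A : Type) [Ring A] [Algebra ℂ A] : Algebra ℂ (ConjOp A) :=
  RingHom.toAlgebra' (S := Aᵐᵒᵖ) ((algebraMap ℂ Aᵐᵒᵖ).comp (starRingEnd ℂ))
    (fun c x => Algebra.commutes (A := Aᵐᵒᵖ) (starRingEnd ℂ c) x)

/-- The tautological map from `A` to its conjugate-opposite. -/
def mk {A : Type} (a : A) : ConjOp A := MulOpposite.op a

/-- The tautological map from the conjugate-opposite of `A` to `A`. -/
def out {A : Type} (a : ConjOp A) : A := MulOpposite.unop a

variable {A : Type} [Ring A]

theorem mk_mul (a b : A) : mk (a * b) = mk b * mk a := rfl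
theorem mk_one : mk (1 : A) = 1 := rfl
theorem mk_zero : mk (0 : A) = 0 := rfl
theorem mk_pow (a : A) (n : ℕ) : mk (a ^ n) = mk a ^ n := MulOpposite.op_pow a n
theorem out_mul (a b : ConjOp A) : out (a * b) = out b * out a := rfl
theorem out_add (a b : ConjOp A) : out (a + b) = out a + out b := rfl
theorem out_mk (a : A) : out (mk a) = a := rfl

variable [Algebra ℂ A]

theorem smul_mk (c : ℂ) (a : A) : c • mk a = mk (starRingEnd ℂ c • a) := by
  rw [Algebra.smul_def, Algebra.smul_def, mk_mul]
  exact Algebra.commutes (A := ConjOp A) c (mk a)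

theorem out_smul (c : ℂ) (a : ConjOp A) : out (c • a) = starRingEnd ℂ c • out a :=
  congrArg out (smul_mk c (out a))

theorem out_algebraMap (c : ℂ) :
    out (algebraMap ℂ (ConjOp A) c) = algebraMap ℂ A (starRingEnd ℂ c) := rfl

end ConjOp

/-! ### The reduced quantum Poincaré group `E(1,1|p)` -/

/-- Names of the generators `η₊`, `η₋`, `δ`. -/
inductive AGen : Type
  | etaP | etaM | delta

/-- The relations `η₋ η₊ = q² η₊ η₋`, `η_± δ = q² δ η_±`, `δ ^ p = 1`, `η_± ^ p = 0`. -/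
inductive ARel (p : ℕ) (q : ℂ) : FreeAlgebra ℂ AGen → FreeAlgebra ℂ AGen → Prop
  | eta_eta : ARel p q (FreeAlgebra.ι ℂ AGen.etaM * FreeAlgebra.ι ℂ AGen.etaP)
      (q ^ 2 • (FreeAlgebra.ι ℂ AGen.etaP * FreeAlgebra.ι ℂ AGen.etaM))
  | etaP_delta : ARel p q (FreeAlgebra.ι ℂ AGen.etaP * FreeAlgebra.ι ℂ AGen.delta)
      (q ^ 2 • (FreeAlgebra.ι ℂ AGen.delta * FreeAlgebra.ι ℂ AGen.etaP))
  | etaM_delta : ARel p q (FreeAlgebra.ι ℂ AGen.etaM * FreeAlgebra.ι ℂ AGen.delta)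
      (q ^ 2 • (FreeAlgebra.ι ℂ AGen.delta * FreeAlgebra.ι ℂ AGen.etaM))
  | delta_pow : ARel p q (FreeAlgebra.ι ℂ AGen.delta ^ p) 1
  | etaP_pow : ARel p q (FreeAlgebra.ι ℂ AGen.etaP ^ p) 0
  | etaM_pow : ARel p q (FreeAlgebra.ι ℂ AGen.etaM ^ p) 0

/-- The algebra `A(E(1,1|p))` of polynomials in `η₊`, `η₋` and `δ` (note `δ⁻¹ = δ ^ (p - 1)`). -/
def ARed (p : ℕ) (q : ℂ) : Type := RingQuot (ARel p q)

namespace ARed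

variable (p : ℕ) (q : ℂ)

instance : Ring (ARed p q) := inferInstanceAs (Ring (RingQuot (ARel p q)))
instance : Algebra ℂ (ARed p q) := inferInstanceAs (Algebra ℂ (RingQuot (ARel p q)))

/-- The quotient map from the free algebra. -/
def proj : FreeAlgebra ℂ AGen →ₐ[ℂ] ARed p q := RingQuot.mkAlgHom ℂ (ARel p q)

/-- The generators of `A(E(1,1|p))`. -/
def gen (g : AGen) : ARed p q := proj p q (FreeAlgebra.ι ℂ g)

variable {p q}

theorem proj_rel {a b : FreeAlgebra ℂ AGen} (h : ARel p q a b) : proj p q a = proj p q b :=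
  RingQuot.mkAlgHom_rel ℂ h

theorem eta_eta : gen p q .etaM * gen p q .etaP = q ^ 2 • (gen p q .etaP * gen p q .etaM) := by
  simpa [gen] using proj_rel (p := p) (q := q) ARel.eta_eta

theorem etaP_delta :
    gen p q .etaP * gen p q .delta = q ^ 2 • (gen p q .delta * gen p q .etaP) := by
  simpa [gen] using proj_rel (p := p) (q := q) ARel.etaP_delta

theorem etaM_delta :
    gen p q .etaM * gen p q .delta = q ^ 2 • (gen p q .delta * gen p q .etaM) := by
  simpa [gen] using proj_rel (p := p) (q := q) ARel.etaM_delta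

theorem delta_pow : gen p q .delta ^ p = 1 := by
  simpa [gen] using proj_rel (p := p) (q := q) ARel.delta_pow

theorem etaP_pow : gen p q .etaP ^ p = 0 := by
  simpa [gen] using proj_rel (p := p) (q := q) ARel.etaP_pow

theorem etaM_pow : gen p q .etaM ^ p = 0 := by
  simpa [gen] using proj_rel (p := p) (q := q) ARel.etaM_pow

variable (p q)

theorem conj_mul_self [NeZero p] [h : Fact (IsPrimitiveRoot q p)] :
    starRingEnd ℂ q * q = 1 := by
  rw [mul_comm, Complex.mul_conj, Complex.normSq_eq_norm_sq,
    Complex.norm_eq_one_of_pow_eq_one h.out.pow_eq_one (NeZero.ne p)]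
  norm_num

theorem conj_aux [NeZero p] [Fact (IsPrimitiveRoot q p)] {x y : ARed p q}
    (h : y = q ^ 2 • x) : (starRingEnd ℂ (q ^ 2)) • y = x := by
  rw [h, smul_smul, map_pow, ← mul_pow, conj_mul_self p q, one_pow, one_smul]

/-- The involution of `A(E(1,1|p))`, as a homomorphism to the conjugate-opposite algebra:
it is conjugate-linear, reverses products, and fixes `η₊`, `η₋` and `δ`. -/
def starHom [NeZero p] [Fact (IsPrimitiveRoot q p)] : ARed p q →ₐ[ℂ] ConjOp (ARed p q) :=
  RingQuot.liftAlgHom ℂ (s := ARel p q)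
    ⟨FreeAlgebra.lift ℂ (fun g => ConjOp.mk (gen p q g)), by
      intro x y h
      cases h
      · simp only [map_mul, map_smul, FreeAlgebra.lift_ι_apply, ← ConjOp.mk_mul, ConjOp.smul_mk]
        rw [conj_aux p q eta_eta]
      · simp only [map_mul, map_smul, FreeAlgebra.lift_ι_apply, ← ConjOp.mk_mul, ConjOp.smul_mk]
        rw [conj_aux p q etaP_delta]
      · simp only [map_mul, map_smul, FreeAlgebra.lift_ι_apply, ← ConjOp.mk_mul, ConjOp.smul_mk]
        rw [conj_aux p q etaM_delta]
      · simp only [map_pow, map_one, FreeAlgebra.lift_ι_apply, ← ConjOp.mk_pow, delta_pow]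
        rfl
      · simp only [map_pow, map_zero, FreeAlgebra.lift_ι_apply, ← ConjOp.mk_pow, etaP_pow]
        rfl
      · simp only [map_pow, map_zero, FreeAlgebra.lift_ι_apply, ← ConjOp.mk_pow, etaM_pow]
        rfl⟩

variable {p q}
variable [NeZero p] [Fact (IsPrimitiveRoot q p)]

theorem starHom_gen (g : AGen) : starHom p q (gen p q g) = ConjOp.mk (gen p q g) := by
  have h : starHom p q (gen p q g) =
      FreeAlgebra.lift ℂ (fun g => ConjOp.mk (gen p q g)) (FreeAlgebra.ι ℂ g) :=
    RingQuot.liftAlgHom_mkAlgHom_apply ℂ _ _ _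
  rw [h, FreeAlgebra.lift_ι_apply]

theorem proj_surjective : Function.Surjective (proj p q) :=
  RingQuot.mkAlgHom_surjective ℂ (ARel p q)

theorem starHom_starHom (a : ARed p q) :
    (starHom p q (starHom p q a).out).out = a := by
  obtain ⟨x, rfl⟩ := proj_surjective a
  induction x using FreeAlgebra.induction with
  | grade0 r =>
    rw [AlgHom.commutes, AlgHom.commutes, ConjOp.out_algebraMap, AlgHom.commutes,
      ConjOp.out_algebraMap, Complex.conj_conj]
  | grade1 g =>
    change (starHom p q (starHom p q (gen p q g)).out).out = gen p q g
    rw [starHom_gen, ConjOp.out_mk, starHom_gen, ConjOp.out_mk]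
  | mul a b ha hb =>
    rw [map_mul, map_mul, ConjOp.out_mul, map_mul, ConjOp.out_mul, ha, hb]
  | add a b ha hb =>
    rw [map_add, map_add, ConjOp.out_add, map_add, ConjOp.out_add, ha, hb]

instance : StarRing (ARed p q) where
  star a := (starHom p q a).out
  star_involutive := starHom_starHom
  star_mul a b := by rw [map_mul, ConjOp.out_mul]
  star_add a b := by rw [map_add, ConjOp.out_add]

instance : StarModule ℂ (ARed p q) where
  star_smul c a := by
    change (starHom p q (c • a)).out = starRingEnd ℂ c • (starHom p q a).out
    rw [map_smul, ConjOp.out_smul]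

theorem star_gen (g : AGen) : star (gen p q g) = gen p q g := by
  change (starHom p q (gen p q g)).out = gen p q g
  rw [starHom_gen, ConjOp.out_mk]

end ARed

/-! ### The quantum Poincaré group `E_q(1,1)` -/

/-- The `*`-algebra `C^∞(ℝ²)` of complex valued smooth functions of `z = (z₊, z₋)`. -/
def Smooth : StarSubalgebra ℂ (ℝ × ℝ → ℂ) where
  carrier := {f | ContDiff ℝ ∞ f}
  mul_mem' {f g} hf hg := by
    have h1 : ContDiff ℝ ∞ f := hf
    have h2 : ContDiff ℝ ∞ g := hg
    exact h1.mul h2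
  add_mem' {f g} hf hg := by
    have h1 : ContDiff ℝ ∞ f := hf
    have h2 : ContDiff ℝ ∞ g := hg
    exact h1.add h2
  algebraMap_mem' c := by
    change ContDiff ℝ ∞ (fun _ : ℝ × ℝ => c)
    exact contDiff_const
  star_mem' hf := (Complex.conjCLE.contDiff (n := ∞)).comp hf

/-- The `*`-algebra `A(E_q(1,1)) = A(E(1,1|p)) × C^∞(ℝ²)`, whose elements are finite sums
`∑ aₙ fₙ`; the functions of `z_±` commute with `η_±` and `δ`. -/
abbrev AE (p : ℕ) (q : ℂ) : Type := ARed p q ⊗[ℂ] Smooth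

/-- `η₊` in `A(E_q(1,1))`. -/
def etaP (p : ℕ) (q : ℂ) : AE p q := ARed.gen p q .etaP ⊗ₜ[ℂ] 1
/-- `η₋` in `A(E_q(1,1))`. -/
def etaM (p : ℕ) (q : ℂ) : AE p q := ARed.gen p q .etaM ⊗ₜ[ℂ] 1
/-- `δ` in `A(E_q(1,1))`. -/
def delta (p : ℕ) (q : ℂ) : AE p q := ARed.gen p q .delta ⊗ₜ[ℂ] 1
/-- A smooth function `f(z₊, z₋)` in `A(E_q(1,1))`. -/
def ofSmooth (p : ℕ) (q : ℂ) (f : Smooth) : AE p q := 1 ⊗ₜ[ℂ] f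

/-- `ξ = q η₊ η₋`. -/
def xi (p : ℕ) (q : ℂ) : AE p q := q • (etaP p q * etaM p q)

theorem contDiff_planeWave (cP cM : ℂ) : ContDiff ℝ ∞ (fun z : ℝ × ℝ =>
    Complex.exp (-Complex.I * cP * (z.1 : ℂ) - Complex.I * cM * (z.2 : ℂ))) :=
  ContDiff.cexp (ContDiff.sub
    (contDiff_const.mul (Complex.ofRealCLM.contDiff.comp contDiff_fst))
    (contDiff_const.mul (Complex.ofRealCLM.contDiff.comp contDiff_snd)))

/-- The plane wave `exp(-i c₊ z₊ - i c₋ z₋)` as an element of `A(E_q(1,1))`. -/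
def planeWave (p : ℕ) (q : ℂ) (cP cM : ℂ) : AE p q :=
  ofSmooth p q ⟨fun z => Complex.exp (-Complex.I * cP * (z.1 : ℂ) - Complex.I * cM * (z.2 : ℂ)),
    contDiff_planeWave cP cM⟩

/-! ### The subgroup `SO(1,1|p)` -/

/-- The algebra `A(SO(1,1|p))` of polynomials in `δ` with `δ ^ p = 1`, with basis `δ ^ m`,
`m ∈ ℤ/p`. -/
def SO (p : ℕ) : Type := AddMonoidAlgebra ℂ (ZMod p)

namespace SO

variable (p : ℕ)

instance : CommRing (SO p) := inferInstanceAs (CommRing (AddMonoidAlgebra ℂ (ZMod p)))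
instance : Algebra ℂ (SO p) := inferInstanceAs (Algebra ℂ (AddMonoidAlgebra ℂ (ZMod p)))

/-- The basis vector `δ ^ m`, `m ∈ ℤ/p`. -/
def deltaPow (m : ZMod p) : SO p := AddMonoidAlgebra.single m (1 : ℂ)

/-- The coordinates of an element with respect to the basis `δ ^ m`, `m ∈ ℤ/p`. -/
def coeffs : SO p ≃ₗ[ℂ] (ZMod p →₀ ℂ) := AddMonoidAlgebra.coeffLinearEquiv ℂ

/-- The basis `δ ^ m`, `m ∈ ℤ/p`. -/
def basis : Module.Basis (ZMod p) ℂ (SO p) := Module.Basis.ofRepr (coeffs p)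

theorem basis_apply (m : ZMod p) : basis p m = deltaPow p m := rfl

theorem deltaPow_mul (m n : ZMod p) : deltaPow p m * deltaPow p n = deltaPow p (m + n) := by
  have h := AddMonoidAlgebra.single_mul_single m n (1 : ℂ) (1 : ℂ)
  rw [one_mul] at h
  exact h

theorem deltaPow_zero : deltaPow p 0 = 1 := rfl

/-- The element `δ`. -/
def delta : SO p := deltaPow p 1

theorem delta_pow (n : ℕ) : delta p ^ n = deltaPow p n := by
  induction n with
  | zero => simp [deltaPow_zero]
  | succ k ih => rw [pow_succ, ih, delta, deltaPow_mul, Nat.cast_succ]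

theorem delta_pow_self : delta p ^ p = 1 := by
  rw [delta_pow, ZMod.natCast_self, deltaPow_zero]

/-- Complex conjugation of the coordinates, as a ring homomorphism. -/
def conjHom : SO p →+* SO p := AddMonoidAlgebra.mapRingHom (ZMod p) (starRingEnd ℂ)

theorem coeffs_conjHom (a : SO p) (m : ZMod p) :
    coeffs p (conjHom p a) m = starRingEnd ℂ (coeffs p a m) :=
  congrArg (fun f : AddMonoidAlgebra ℂ (ZMod p) => f.coeff m)
    (rfl : AddMonoidAlgebra.mapRingHom (ZMod p) (starRingEnd ℂ)
      (show AddMonoidAlgebra ℂ (ZMod p) from a) = _) |>.trans (by simp; rfl)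

theorem coeffs_ext {a b : SO p} (h : ∀ m, coeffs p a m = coeffs p b m) : a = b :=
  (coeffs p).injective (Finsupp.ext h)

/-- The involution of `A(SO(1,1|p))`: it conjugates the coordinates, so that it is
conjugate-linear and fixes `δ`. -/
instance : StarRing (SO p) where
  star a := conjHom p a
  star_involutive a := coeffs_ext p fun m => by
    rw [coeffs_conjHom, coeffs_conjHom, Complex.conj_conj]
  star_mul a b := (map_mul (conjHom p) a b).trans (mul_comm _ _)
  star_add a b := map_add (conjHom p) a b

theorem star_def (a : SO p) : star a = conjHom p a := rfl

instance : StarModule ℂ (SO p) where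
  star_smul c a := coeffs_ext p fun m => by
    rw [star_def, star_def, coeffs_conjHom, map_smul, map_smul, Finsupp.smul_apply,
      Finsupp.smul_apply, coeffs_conjHom, smul_eq_mul, smul_eq_mul, map_mul]
    rfl

theorem coeffs_deltaPow (m : ZMod p) : coeffs p (deltaPow p m) = Finsupp.single m 1 := rfl

theorem star_deltaPow (m : ZMod p) : star (deltaPow p m) = deltaPow p m :=
  coeffs_ext p fun n => by
    rw [star_def, coeffs_conjHom, coeffs_deltaPow, Finsupp.single_apply]
    split_ifs <;> simp

/-- The invariant integral on `SO(1,1|p)`: it sends `δ ^ m` to `1` if `m = 0` in `ℤ/p`, and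
to `0` otherwise. -/
def integral : SO p →ₗ[ℂ] ℂ := (basis p).coord 0

/-- The Hermitian form `(a, b)_S = I_S(a^* b)`. -/
def form (a b : SO p) : ℂ := integral p (star a * b)

/-- The diagonal operator `δ ^ m ↦ q ^ m δ ^ m`. -/
def diag (q : ℂ) : Module.End ℂ (SO p) :=
  (basis p).constr ℂ (fun m => q ^ m.val • deltaPow p m)

theorem diag_deltaPow (q : ℂ) (m : ZMod p) :
    diag p q (deltaPow p m) = q ^ m.val • deltaPow p m :=
  (basis p).constr_basis ℂ _ m

/-- The shift operator `a ↦ δ ^ j a`. -/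
def shift (j : ZMod p) : Module.End ℂ (SO p) := LinearMap.mulLeft ℂ (deltaPow p j)

theorem shift_deltaPow (j m : ZMod p) :
    shift p j (deltaPow p m) = deltaPow p (j + m) := deltaPow_mul p j m

end SO

/-! ### The quantum algebra `U_q(e(1,1))` and its representations `L^λ` -/

/-- Names of the generators `p₊`, `p₋`, `κ`. -/
inductive UGen : Type
  | pP | pM | kappa

/-- The relations `p₊ p₋ = p₋ p₊`, `p_± κ = q ^ (∓ 1) κ p_±`, `κ ^ p = 1`. -/
inductive URel (p : ℕ) (q : ℂ) : FreeAlgebra ℂ UGen → FreeAlgebra ℂ UGen → Prop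
  | p_comm : URel p q (FreeAlgebra.ι ℂ UGen.pP * FreeAlgebra.ι ℂ UGen.pM)
      (FreeAlgebra.ι ℂ UGen.pM * FreeAlgebra.ι ℂ UGen.pP)
  | pP_kappa : URel p q (FreeAlgebra.ι ℂ UGen.pP * FreeAlgebra.ι ℂ UGen.kappa)
      (q⁻¹ • (FreeAlgebra.ι ℂ UGen.kappa * FreeAlgebra.ι ℂ UGen.pP))
  | pM_kappa : URel p q (FreeAlgebra.ι ℂ UGen.pM * FreeAlgebra.ι ℂ UGen.kappa)
      (q • (FreeAlgebra.ι ℂ UGen.kappa * FreeAlgebra.ι ℂ UGen.pM))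
  | kappa_pow : URel p q (FreeAlgebra.ι ℂ UGen.kappa ^ p) 1

/-- The algebra `U_q(e(1,1))` generated by `p₊`, `p₋` and `κ`. -/
def UE (p : ℕ) (q : ℂ) : Type := RingQuot (URel p q)

namespace UE

variable (p : ℕ) (q : ℂ)

instance : Ring (UE p q) := inferInstanceAs (Ring (RingQuot (URel p q)))
instance : Algebra ℂ (UE p q) := inferInstanceAs (Algebra ℂ (RingQuot (URel p q)))

/-- The generators of `U_q(e(1,1))`. -/
def gen (g : UGen) : UE p q := RingQuot.mkAlgHom ℂ (URel p q) (FreeAlgebra.ι ℂ g)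

/-- `κ⁻¹ = κ ^ (p - 1)`. -/
def kappaInv : UE p q := gen p q .kappa ^ (p - 1)

theorem kappa_mul_kappaInv [NeZero p] : gen p q .kappa * kappaInv p q = 1 := by
  rw [kappaInv, ← pow_succ', Nat.sub_add_cancel (NeZero.pos p)]
  have h := RingQuot.mkAlgHom_rel ℂ (URel.kappa_pow (p := p) (q := q))
  rw [map_pow, map_one] at h
  exact h

/-- `P₊ = p₊ ^ p`. -/
def bigPP : UE p q := gen p q .pP ^ p
/-- `P₋ = p₋ ^ p`. -/
def bigPM : UE p q := gen p q .pM ^ p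

/-- `ε₊ = - q ^ (-1/2) p₊ κ⁻¹`, with `s` for `q ^ (1/2)`. -/
def epsP (s : ℂ) : UE p q := -(s⁻¹ • (gen p q .pP * kappaInv p q))
/-- `ε₋ = - q ^ (1/2) p₋ κ⁻¹`, with `s` for `q ^ (1/2)`. -/
def epsM (s : ℂ) : UE p q := -(s • (gen p q .pM * kappaInv p q))

/-- The operators `L^λ(p_±)`, `L^λ(κ)`. -/
def opGen (lP lM : ℂ) : UGen → Module.End ℂ (SO p)
  | .pP => lP • SO.shift p 1
  | .pM => lM • SO.shift p (-1)
  | .kappa => SO.diag p q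

variable {p q}

theorem q_ne_zero [NeZero p] [h : Fact (IsPrimitiveRoot q p)] : q ≠ 0 :=
  h.out.ne_zero (NeZero.ne p)

theorem pow_val_add_one [NeZero p] [h : Fact (IsPrimitiveRoot q p)] (m : ZMod p) :
    q ^ (1 + m).val = q * q ^ m.val := by
  rw [← pow_succ']
  refine pow_eq_pow_of_modEq ?_ h.out.pow_eq_one
  rw [← ZMod.natCast_eq_natCast_iff]
  simp [add_comm]

theorem pow_val_sub_one [NeZero p] [Fact (IsPrimitiveRoot q p)] (m : ZMod p) :
    q * q ^ (-1 + m).val = q ^ m.val := by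
  rw [← pow_val_add_one]
  simp

variable (p q)

/-- The representation `L^λ` of `U_q(e(1,1))` in `A(SO(1,1|p))`:
`L^λ(p_±) δ ^ m = λ_± δ ^ (m ± 1)` and `L^λ(κ) δ ^ m = q ^ m δ ^ m`. -/
def rep [NeZero p] [Fact (IsPrimitiveRoot q p)] (lP lM : ℂ) :
    UE p q →ₐ[ℂ] Module.End ℂ (SO p) :=
  RingQuot.liftAlgHom ℂ (s := URel p q)
    ⟨FreeAlgebra.lift ℂ (opGen p q lP lM), by
      intro x y h
      have hq : q ≠ 0 := q_ne_zero (p := p)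
      cases h
      · simp only [map_mul, FreeAlgebra.lift_ι_apply, opGen]
        refine (SO.basis p).ext fun m => ?_
        simp only [SO.basis_apply, Module.End.mul_apply, LinearMap.smul_apply, map_smul,
          SO.shift_deltaPow, smul_smul]
        rw [mul_comm, add_left_comm]
      · simp only [map_mul, map_smul, FreeAlgebra.lift_ι_apply, opGen]
        refine (SO.basis p).ext fun m => ?_
        simp only [SO.basis_apply, Module.End.mul_apply, LinearMap.smul_apply, map_smul,
          SO.shift_deltaPow, SO.diag_deltaPow, smul_smul]
        rw [pow_val_add_one]
        congr 1
        field_simp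
      · simp only [map_mul, map_smul, FreeAlgebra.lift_ι_apply, opGen]
        refine (SO.basis p).ext fun m => ?_
        simp only [SO.basis_apply, Module.End.mul_apply, LinearMap.smul_apply, map_smul,
          SO.shift_deltaPow, SO.diag_deltaPow, smul_smul]
        rw [← pow_val_sub_one m]
        congr 1
        ring
      · simp only [map_pow, map_one, FreeAlgebra.lift_ι_apply, opGen]
        refine (SO.basis p).ext fun m => ?_
        have key : ∀ k : ℕ, (SO.diag p q ^ k) (SO.deltaPow p m) =
            (q ^ m.val) ^ k • SO.deltaPow p m := by
          intro k
          induction k with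
          | zero => simp
          | succ k ih =>
            rw [pow_succ', Module.End.mul_apply, ih, map_smul, SO.diag_deltaPow, smul_smul,
              pow_succ]
        rw [SO.basis_apply, key, ← pow_mul, mul_comm, pow_mul,
          (Fact.out : IsPrimitiveRoot q p).pow_eq_one, one_pow, one_smul, Module.End.one_apply]⟩

variable [NeZero p] [Fact (IsPrimitiveRoot q p)]

theorem rep_gen (lP lM : ℂ) (g : UGen) : rep p q lP lM (gen p q g) = opGen p q lP lM g := by
  have h : rep p q lP lM (gen p q g) =
      FreeAlgebra.lift ℂ (opGen p q lP lM) (FreeAlgebra.ι ℂ g) :=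
    RingQuot.liftAlgHom_mkAlgHom_apply ℂ _ _ _
  rw [h, FreeAlgebra.lift_ι_apply]

end UE

/-! ### The representations `T^λ` of `E_q(1,1)` and their matrix elements -/

section Exponential

open scoped Matrix.Norms.Operator

/-- Entries of the exponential of a smooth matrix-valued function are smooth. -/
theorem contDiff_exp_entry {ι : Type} [Fintype ι] [DecidableEq ι] (M N : Matrix ι ι ℂ)
    (r t : ι) : ContDiff ℝ ∞ (fun z : ℝ × ℝ =>
      NormedSpace.exp (-(Complex.I * (z.1 : ℂ)) • M - (Complex.I * (z.2 : ℂ)) • N) r t) := by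
  have h1 : ContDiff ℝ ∞ (NormedSpace.exp : Matrix ι ι ℂ → Matrix ι ι ℂ) :=
    contDiff_iff_contDiffAt.2 fun x => (NormedSpace.exp_analytic (𝕂 := ℝ) x).contDiffAt
  have h2 : ContDiff ℝ ∞ (fun z : ℝ × ℝ =>
      -(Complex.I * (z.1 : ℂ)) • M - (Complex.I * (z.2 : ℂ)) • N) := by
    have g1 : ContDiff ℝ ∞ (fun z : ℝ × ℝ => -(Complex.I * (z.1 : ℂ))) :=
      (contDiff_const.mul (Complex.ofRealCLM.contDiff.comp contDiff_fst)).neg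
    have g2 : ContDiff ℝ ∞ (fun z : ℝ × ℝ => Complex.I * (z.2 : ℂ)) :=
      contDiff_const.mul (Complex.ofRealCLM.contDiff.comp contDiff_snd)
    have k1 : ContDiff ℝ ∞ (fun z : ℝ × ℝ => -(Complex.I * (z.1 : ℂ)) • M) :=
      g1.smul contDiff_const
    have k2 : ContDiff ℝ ∞ (fun z : ℝ × ℝ => (Complex.I * (z.2 : ℂ)) • N) :=
      g2.smul contDiff_const
    exact k1.sub k2
  have h3 : ContDiff ℝ ∞ (fun A : Matrix ι ι ℂ => A r t) :=
    (LinearMap.toContinuousLinearMap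
      ({ toFun := fun A => A r t, map_add' := fun _ _ => rfl, map_smul' := fun _ _ => rfl } :
        Matrix ι ι ℂ →ₗ[ℝ] ℂ)).contDiff
  exact h3.comp (h1.comp h2)

end Exponential

variable (p : ℕ) (q : ℂ) [NeZero p]

/-- The algebra `Lin(A(SO(1,1|p))) ⊗ A(E_q(1,1))`. -/
abbrev OpAE : Type := Module.End ℂ (SO p) ⊗[ℂ] AE p q

/-- The exponential `exp(-i X ⊗ z₊ - i Y ⊗ z₋)` for operators `X`, `Y` in `A(SO(1,1|p))`: the
operator valued smooth function `(z₊, z₋) ↦ exp(-i z₊ X - i z₋ Y)`, written in matrix units. -/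
def opExp (X Y : Module.End ℂ (SO p)) : OpAE p q :=
  ∑ r : ZMod p, ∑ t : ZMod p,
    (Matrix.toLin (SO.basis p) (SO.basis p) (Matrix.single r t 1)) ⊗ₜ[ℂ]
      ofSmooth p q ⟨fun z => NormedSpace.exp
        (-(Complex.I * (z.1 : ℂ)) • LinearMap.toMatrix (SO.basis p) (SO.basis p) X
          - (Complex.I * (z.2 : ℂ)) • LinearMap.toMatrix (SO.basis p) (SO.basis p) Y) r t,
        contDiff_exp_entry _ _ r t⟩

/-- `D(K, δ) = (1/p) ∑_{m, k} q ^ (-m k) K ^ m ⊗ δ ^ k` for an operator `K`. -/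
def opD (K : Module.End ℂ (SO p)) : OpAE p q :=
  (p : ℂ)⁻¹ • ∑ m ∈ Finset.range p, ∑ k ∈ Finset.range p,
    (q ^ (m * k))⁻¹ • ((K ^ m) ⊗ₜ[ℂ] (delta p q ^ k))

/-- The action of `Lin(A(SO(1,1|p))) ⊗ A(E_q(1,1))` on the elements `a ⊗ 1`:
`(X ⊗ F)(a ⊗ 1) = X a ⊗ F`. -/
def applyOp : OpAE p q →ₗ[ℂ] SO p →ₗ[ℂ] SO p ⊗[ℂ] AE p q :=
  TensorProduct.lift (LinearMap.mk₂ ℂ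
    (fun (X : Module.End ℂ (SO p)) (F : AE p q) =>
      ((TensorProduct.mk ℂ (SO p) (AE p q)).flip F) ∘ₗ X)
    (by intros; ext; simp)
    (by intros; ext; simp [TensorProduct.smul_tmul'])
    (by intros; ext; simp)
    (by intros; ext; simp))

theorem applyOp_tmul (X : Module.End ℂ (SO p)) (F : AE p q) (a : SO p) :
    applyOp p q (X ⊗ₜ[ℂ] F) a = X a ⊗ₜ[ℂ] F := rfl

variable [Fact (IsPrimitiveRoot q p)]

/-- The universal `T`-matrix in the representation `L^λ`:
`exp(-i L(P₊) ⊗ z₊ - i L(P₋) ⊗ z₋) e₊ ^ (i L(ε₊) ⊗ η₊) e₋ ^ (i L(ε₋) ⊗ η₋) D(L(κ), δ)`,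
where `s` stands for `q ^ (1/2)`. -/
def opT (s lP lM : ℂ) : OpAE p q :=
  opExp p q (UE.rep p q lP lM (UE.bigPP p q)) (UE.rep p q lP lM (UE.bigPM p q)) *
  cutoffExp p q 1 (Complex.I • (UE.rep p q lP lM (UE.epsP p q s) ⊗ₜ[ℂ] etaP p q)) *
  cutoffExp p q (-1) (Complex.I • (UE.rep p q lP lM (UE.epsM p q s) ⊗ₜ[ℂ] etaM p q)) *
  opD p q (UE.rep p q lP lM (UE.gen p q .kappa))

/-- The representation `T^λ : A(SO(1,1|p)) → A(SO(1,1|p)) ⊗ A(E_q(1,1))` of `E_q(1,1)`. -/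
def repT (s lP lM : ℂ) : SO p →ₗ[ℂ] SO p ⊗[ℂ] AE p q := applyOp p q (opT p q s lP lM)

/-- The `A(E_q(1,1))`-valued Hermitian form on `A(SO(1,1|p)) ⊗ A(E_q(1,1))`, which is
`{x, y}_S = (I_S ⊗ id)(x^* y)`; see `formE_tmul`. -/
def formE (x y : SO p ⊗[ℂ] AE p q) : AE p q :=
  TensorProduct.lid ℂ (AE p q) ((SO.integral p).rTensor (AE p q) (star x * y))

/-- `{a ⊗ F, b ⊗ G}_S = (a, b)_S F^* G`. -/
theorem formE_tmul (a b : SO p) (F G : AE p q) :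
    formE p q (a ⊗ₜ[ℂ] F) (b ⊗ₜ[ℂ] G) = SO.form p a b • (star F * G) := by
  simp [formE, SO.form, TensorProduct.star_tmul]

/-- The matrix elements `D^λ_{mn} = {δ ^ (p - m) ⊗ 1, T^λ δ ^ n}_S`, for `m, n ∈ [0, p - 1]`. -/
def matrixElement (s lP lM : ℂ) (m n : ℕ) : AE p q :=
  formE p q ((SO.delta p ^ (p - m)) ⊗ₜ[ℂ] 1) (repT p q s lP lM (SO.delta p ^ n))

end QPoincare

end

open QPoincare

/-!
Everything is computed on the basis `δ ^ n`. The operators `L^λ(P_±) = λ_± ^ p` are scalars, so the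
operator exponential is the plane wave times the identity (`opExp_smul_one`), and `D(κ, δ)` is
a discrete Fourier transform which sends `δ ^ n ⊗ 1` to `δ ^ n ⊗ δ ^ n` (`applyOp_opD`). The
operators `L^λ(ε_±)` are weighted shifts, with weight `q ^ (-r)` at `δ ^ r`; the factors
`q ^ (l (l - 1) / 2)` which their powers produce (`weightedShift_pow`) cancel those of the cut-off
`q`-exponentials. This gives (`repT_delta_pow`), with `w` the plane wave,

`T^λ δ ^ n = ∑_{l, j < p} c_{l j} δ ^ (n - j + l) ⊗ w η₊ ^ l η₋ ^ j δ ^ n`,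
`c_{l j} = (-i s⁻¹ λ₊ q ^ (j - n)) ^ l (-i s λ₋ q ^ (-n)) ^ j / ([l]! [j]!)`.

The form with `δ ^ (p - m)` keeps the terms with `l + n ≡ j + m` modulo `p`
(`matrixElement_eq_sum`). In the square `0 ≤ l, j < p` this condition cuts out two segments
(`sum_sum_ite_natCast_eq`), one on which `η₋` prevails and one on which `η₊` does: these are the two
sums of the formula. On each of them `ξ ^ k = q ^ (k²) η₊ ^ k η₋ ^ k` and
`ξ δ = q ^ 4 δ ξ` bring the terms into the stated form (`repTCoeff_smul_of_etaM`,
`repTCoeff_smul_of_etaP`). The column `n = 0` is the special case in which the coefficients are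
those of the Hahn--Exton function, because `q ^ (k (p - m)) = q ^ (-k m)`.
-/

namespace QPoincare

open Finset

/-! ### Relations among `η₊`, `η₋`, `δ` -/

section Commutation

variable {R : Type*} [Ring R] [Algebra ℂ R]

theorem pow_mul_of_qCommute {c : ℂ} {x y : R} (h : x * y = c • (y * x)) (k : ℕ) :
    x ^ k * y = c ^ k • (y * x ^ k) := by
  induction k with
  | zero => simp
  | succ k ih =>
    rw [pow_succ, mul_assoc, h, mul_smul_comm, ← mul_assoc, ih, smul_mul_assoc, smul_smul,
      mul_assoc, ← pow_succ']

theorem pow_mul_pow_of_qCommute {c : ℂ} {x y : R} (h : x * y = c • (y * x)) (k n : ℕ) :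
    x ^ k * y ^ n = c ^ (k * n) • (y ^ n * x ^ k) := by
  induction n with
  | zero => simp
  | succ n ih =>
    rw [pow_succ, ← mul_assoc, ih, smul_mul_assoc, mul_assoc, pow_mul_of_qCommute h,
      mul_smul_comm, smul_smul, ← mul_assoc, Nat.mul_succ, pow_add]

/-- Normal ordering of a power: `(q u v) ^ k = q ^ (k²) u ^ k v ^ k` when `v u = q² u v`. -/
theorem smul_mul_pow_of_qCommute {q : ℂ} {u v : R} (h : v * u = q ^ 2 • (u * v)) (k : ℕ) :
    (q • (u * v)) ^ k = q ^ (k * k) • (u ^ k * v ^ k) := by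
  induction k with
  | zero => simp
  | succ k ih =>
    have : u ^ k * v ^ k * (u * v) = (q ^ 2) ^ k • (u ^ (k + 1) * v ^ (k + 1)) := by
      rw [mul_assoc, ← mul_assoc (v ^ k), pow_mul_of_qCommute h, smul_mul_assoc, mul_smul_comm,
        pow_succ u, pow_succ v]
      simp only [mul_assoc]
    rw [pow_succ, ih, smul_mul_assoc, mul_smul_comm, this, smul_smul, smul_smul]
    congr 1
    ring

end Commutation

theorem etaM_mul_etaP (p : ℕ) (q : ℂ) :
    etaM p q * etaP p q = q ^ 2 • (etaP p q * etaM p q) := by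
  simp [etaM, etaP, ARed.eta_eta, TensorProduct.smul_tmul']

theorem etaP_mul_delta (p : ℕ) (q : ℂ) :
    etaP p q * delta p q = q ^ 2 • (delta p q * etaP p q) := by
  simp [delta, etaP, ARed.etaP_delta, TensorProduct.smul_tmul']

theorem etaM_mul_delta (p : ℕ) (q : ℂ) :
    etaM p q * delta p q = q ^ 2 • (delta p q * etaM p q) := by
  simp [delta, etaM, ARed.etaM_delta, TensorProduct.smul_tmul']

theorem xi_pow (p : ℕ) (q : ℂ) (k : ℕ) :
    xi p q ^ k = q ^ (k * k) • (etaP p q ^ k * etaM p q ^ k) :=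
  smul_mul_pow_of_qCommute (etaM_mul_etaP p q) k

theorem xi_mul_delta (p : ℕ) (q : ℂ) :
    xi p q * delta p q = q ^ 4 • (delta p q * xi p q) := by
  rw [xi, smul_mul_assoc, mul_assoc, etaM_mul_delta, mul_smul_comm, ← mul_assoc, etaP_mul_delta,
    smul_mul_assoc, mul_smul_comm, smul_smul, smul_smul, smul_smul, mul_assoc (delta p q)]
  congr 1
  ring

theorem delta_pow_mul_xi_pow {q : ℂ} (hq : q ≠ 0) (p n k : ℕ) :
    delta p q ^ n * xi p q ^ k = ((q ^ 4) ^ (k * n))⁻¹ • (xi p q ^ k * delta p q ^ n) := by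
  rw [pow_mul_pow_of_qCommute (xi_mul_delta p q), smul_smul, inv_mul_cancel₀ (by positivity),
    one_smul]

/-! ### The operators `L^λ` -/

section Character

variable {p : ℕ} {q : ℂ}

theorem diag_pow_deltaPow (k : ℕ) (r : ZMod p) :
    (SO.diag p q ^ k) (SO.deltaPow p r) = (q ^ r.val) ^ k • SO.deltaPow p r := by
  induction k with
  | zero => simp
  | succ k ih =>
    rw [pow_succ', Module.End.mul_apply, ih, map_smul, SO.diag_deltaPow, smul_smul, pow_succ]

theorem shift_pow (j : ZMod p) (k : ℕ) : SO.shift p j ^ k = SO.shift p (k * j) := by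
  induction k with
  | zero =>
    refine (SO.basis p).ext fun m => ?_
    simp [SO.basis_apply, SO.shift_deltaPow]
  | succ k ih =>
    refine (SO.basis p).ext fun m => ?_
    rw [pow_succ, Module.End.mul_apply, ih, SO.basis_apply, SO.shift_deltaPow, SO.shift_deltaPow,
      SO.shift_deltaPow]
    congr 1
    push_cast
    ring

theorem shift_pow_self (j : ZMod p) : SO.shift p j ^ p = 1 := by
  rw [shift_pow]
  refine (SO.basis p).ext fun m => ?_
  simp [SO.basis_apply, SO.shift_deltaPow]

variable [h : Fact (IsPrimitiveRoot q p)]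

theorem pow_val_natCast (n : ℕ) : q ^ (n : ZMod p).val = q ^ n := by
  refine pow_eq_pow_of_modEq ?_ h.out.pow_eq_one
  rw [← ZMod.natCast_eq_natCast_iff]
  simp

theorem pow_val_one : q ^ (1 : ZMod p).val = q := by
  simpa using pow_val_natCast (p := p) (q := q) 1

variable [NeZero p]

/-- `r ↦ q ^ r` is a character of `ℤ/p`. -/
theorem pow_val_add (a b : ZMod p) : q ^ (a + b).val = q ^ a.val * q ^ b.val := by
  rw [← pow_add]
  refine pow_eq_pow_of_modEq ?_ h.out.pow_eq_one
  rw [← ZMod.natCast_eq_natCast_iff]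
  simp

theorem pow_val_neg (a : ZMod p) : q ^ (-a).val = (q ^ a.val)⁻¹ := by
  refine eq_inv_of_mul_eq_one_left ?_
  rw [← pow_val_add]
  simp

/-- Powers of an operator `δ ^ r ↦ a q ^ (-r) δ ^ (r + t)`. The operators `L^λ(ε_±)` are of this
form with `t = ± 1`. -/
theorem weightedShift_pow {E : Module.End ℂ (SO p)} {a : ℂ} {t : ZMod p}
    (hE : ∀ r, E (SO.deltaPow p r) = (a * (q ^ r.val)⁻¹) • SO.deltaPow p (r + t))
    (l : ℕ) (r : ZMod p) :
    (E ^ l) (SO.deltaPow p r) = ((a * (q ^ r.val)⁻¹) ^ l * ((q ^ t.val)⁻¹) ^ l.choose 2) •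
      SO.deltaPow p (r + l * t) := by
  have hq : q ≠ 0 := UE.q_ne_zero (p := p)
  induction l generalizing r with
  | zero => simp
  | succ l ih =>
    rw [pow_succ, Module.End.mul_apply, hE, map_smul, ih, smul_smul, pow_val_add,
      Nat.choose_succ_succ', Nat.choose_one_right]
    congr 1
    · have hr : q ^ r.val ≠ 0 := pow_ne_zero _ hq
      have ht : q ^ t.val ≠ 0 := pow_ne_zero _ hq
      generalize q ^ r.val = x at *
      generalize q ^ t.val = y at *
      rw [mul_inv]
      ring
    · push_cast
      ring_nf

theorem rep_kappa (lP lM : ℂ) : UE.rep p q lP lM (UE.gen p q .kappa) = SO.diag p q :=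
  UE.rep_gen p q lP lM .kappa

theorem rep_kappaInv_deltaPow (lP lM : ℂ) (r : ZMod p) :
    UE.rep p q lP lM (UE.kappaInv p q) (SO.deltaPow p r) =
      (q ^ r.val)⁻¹ • SO.deltaPow p r := by
  rw [UE.kappaInv, map_pow, rep_kappa, diag_pow_deltaPow]
  congr 1
  refine eq_inv_of_mul_eq_one_left ?_
  rw [← pow_succ, Nat.sub_add_cancel (NeZero.pos p), ← pow_mul, mul_comm, pow_mul,
    h.out.pow_eq_one, one_pow]

theorem rep_epsP_deltaPow (s lP lM : ℂ) (r : ZMod p) :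
    UE.rep p q lP lM (UE.epsP p q s) (SO.deltaPow p r) =
      ((-s⁻¹ * lP) * (q ^ r.val)⁻¹) • SO.deltaPow p (r + 1) := by
  rw [UE.epsP, map_neg, map_smul, map_mul, LinearMap.neg_apply, LinearMap.smul_apply,
    Module.End.mul_apply, rep_kappaInv_deltaPow, UE.rep_gen]
  simp only [UE.opGen, map_smul, LinearMap.smul_apply, SO.shift_deltaPow, smul_smul, ← neg_smul]
  rw [add_comm]
  congr 1
  ring

theorem rep_epsM_deltaPow (s lP lM : ℂ) (r : ZMod p) :
    UE.rep p q lP lM (UE.epsM p q s) (SO.deltaPow p r) =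
      ((-s * lM) * (q ^ r.val)⁻¹) • SO.deltaPow p (r + -1) := by
  rw [UE.epsM, map_neg, map_smul, map_mul, LinearMap.neg_apply, LinearMap.smul_apply,
    Module.End.mul_apply, rep_kappaInv_deltaPow, UE.rep_gen]
  simp only [UE.opGen, map_smul, LinearMap.smul_apply, SO.shift_deltaPow, smul_smul, ← neg_smul]
  rw [add_comm]
  congr 1
  ring

theorem rep_bigPP (lP lM : ℂ) : UE.rep p q lP lM (UE.bigPP p q) = lP ^ p • 1 := by
  rw [UE.bigPP, map_pow, UE.rep_gen, UE.opGen, smul_pow, shift_pow_self]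

theorem rep_bigPM (lP lM : ℂ) : UE.rep p q lP lM (UE.bigPM p q) = lM ^ p • 1 := by
  rw [UE.bigPM, map_pow, UE.rep_gen, UE.opGen, smul_pow, shift_pow_self]

end Character

/-! ### The factors of the universal `T`-matrix -/

section Factors

theorem matrix_exp_smul_one {ι : Type} [Fintype ι] [DecidableEq ι] (c : ℂ) :
    NormedSpace.exp (c • (1 : Matrix ι ι ℂ)) = Complex.exp c • 1 := by
  have h1 : c • (1 : Matrix ι ι ℂ) = Matrix.diagonal fun _ => c := by
    rw [← Matrix.diagonal_one, ← Matrix.diagonal_smul]; simp [Pi.smul_def]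
  have h2 : Complex.exp c • (1 : Matrix ι ι ℂ) = Matrix.diagonal fun _ => Complex.exp c := by
    rw [← Matrix.diagonal_one, ← Matrix.diagonal_smul]; simp [Pi.smul_def]
  rw [h1, h2, Matrix.exp_diagonal]
  congr 1
  funext i
  rw [Pi.coe_exp, Complex.exp_eq_exp_ℂ]

variable (p : ℕ) (q : ℂ)

theorem cutoffExp_smul_tmul (σ : ℤ) (c : ℂ) (X : Module.End ℂ (SO p)) (F : AE p q) :
    cutoffExp p q σ (c • (X ⊗ₜ[ℂ] F)) =
      ∑ l ∈ range p, (q ^ (σ * (l.choose 2 : ℤ)) / qFact q l * c ^ l) •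
        ((X ^ l) ⊗ₜ[ℂ] (F ^ l)) := by
  refine sum_congr rfl fun l _ => ?_
  rw [smul_pow, Algebra.TensorProduct.tmul_pow, smul_smul]

variable [NeZero p]

/-- For scalar operators the exponential is the plane wave. -/
theorem opExp_smul_one (a b : ℂ) :
    opExp p q (a • 1) (b • 1) = (1 : Module.End ℂ (SO p)) ⊗ₜ[ℂ] planeWave p q a b := by
  have key : ∀ (z : ℝ × ℝ), NormedSpace.exp
        (-(Complex.I * (z.1 : ℂ)) •
            LinearMap.toMatrix (SO.basis p) (SO.basis p) (a • (1 : Module.End ℂ (SO p)))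
          - (Complex.I * (z.2 : ℂ)) •
            LinearMap.toMatrix (SO.basis p) (SO.basis p) (b • (1 : Module.End ℂ (SO p)))) =
      Complex.exp (-Complex.I * a * (z.1 : ℂ) - Complex.I * b * (z.2 : ℂ)) •
        (1 : Matrix (ZMod p) (ZMod p) ℂ) := by
    intro z
    rw [map_smul, map_smul, LinearMap.toMatrix_one, smul_smul, smul_smul, ← sub_smul,
      matrix_exp_smul_one]
    congr 2
    ring
  have hone : (1 : Module.End ℂ (SO p)) =
      ∑ r : ZMod p, Matrix.toLin (SO.basis p) (SO.basis p) (Matrix.single r r 1) := by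
    rw [← map_sum, Matrix.sum_single_one, Matrix.toLin_one]
    rfl
  rw [opExp]
  conv_rhs => rw [hone, TensorProduct.sum_tmul]
  refine sum_congr rfl fun r _ => ?_
  rw [sum_eq_single r]
  · congr 2
    refine Subtype.ext (funext fun z => (congrFun (congrFun (key z) r) r).trans ?_)
    simp
  · intro t _ ht
    have hzero : ∀ f : Smooth, f = 0 → ofSmooth p q f = 0 := fun f hf => by
      rw [hf, ofSmooth, TensorProduct.tmul_zero]
    have hentry : ∀ z : ℝ × ℝ,
        (Complex.exp (-Complex.I * a * (z.1 : ℂ) - Complex.I * b * (z.2 : ℂ)) •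
          (1 : Matrix (ZMod p) (ZMod p) ℂ)) r t = 0 := fun z => by
      simp [Matrix.one_apply_ne ht.symm]
    rw [hzero _ (Subtype.ext (funext fun z =>
      (congrFun (congrFun (key z) r) t).trans (hentry z))), TensorProduct.tmul_zero]
  · simp

/-- The action of an elementary operator on `A(SO(1,1|p)) ⊗ A(E_q(1,1))` is compatible with
products in `Lin(A(SO(1,1|p))) ⊗ A(E_q(1,1))`. -/
theorem applyOp_tmul_mul (X : Module.End ℂ (SO p)) (F : AE p q) (Y : OpAE p q) (a : SO p) :
    applyOp p q (X ⊗ₜ[ℂ] F * Y) a =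
      TensorProduct.map X (LinearMap.mulLeft ℂ F) (applyOp p q Y a) := by
  induction Y using TensorProduct.induction_on with
  | zero => simp
  | add x y hx hy => rw [mul_add, map_add, LinearMap.add_apply, hx, hy, map_add,
      LinearMap.add_apply, map_add]
  | tmul Z G =>
    rw [Algebra.TensorProduct.tmul_mul_tmul, applyOp_tmul, applyOp_tmul, TensorProduct.map_tmul]
    rfl

variable [h : Fact (IsPrimitiveRoot q p)]

/-- `∑_m (q ^ n / q ^ k) ^ m` is `p` if `k = n` and `0` otherwise. -/
theorem sum_inv_pow_mul_pow {k n : ℕ} (hk : k < p) (hn : n < p) :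
    ∑ m ∈ range p, (q ^ (m * k))⁻¹ * (q ^ n) ^ m = if k = n then (p : ℂ) else 0 := by
  have hq : q ≠ 0 := UE.q_ne_zero (p := p)
  have h1 : ∀ m, (q ^ (m * k))⁻¹ * (q ^ n) ^ m = (q ^ n / q ^ k) ^ m := fun m => by
    rw [div_pow, mul_comm m k, pow_mul]
    field_simp
  simp only [h1]
  split_ifs with hkn
  · subst hkn
    rw [div_self (pow_ne_zero _ hq)]
    simp
  · have hne : q ^ n / q ^ k ≠ 1 := fun he => by
      rw [div_eq_one_iff_eq (pow_ne_zero _ hq)] at he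
      exact hkn (h.out.pow_inj hk hn he.symm)
    rw [geom_sum_eq hne, div_pow, ← pow_mul, ← pow_mul, mul_comm n, mul_comm k, pow_mul, pow_mul,
      h.out.pow_eq_one]
    simp

/-- `D(κ, δ)` acts on `δ ^ n` as the coaction `δ ^ n ↦ δ ^ n ⊗ δ ^ n`. -/
theorem applyOp_opD {n : ℕ} (hn : n < p) :
    applyOp p q (opD p q (SO.diag p q)) (SO.deltaPow p n) =
      SO.deltaPow p n ⊗ₜ[ℂ] (delta p q ^ n) := by
  have hp0 : (p : ℂ) ≠ 0 := Nat.cast_ne_zero.2 (NeZero.ne p)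
  simp only [opD, map_smul, map_sum, LinearMap.smul_apply, LinearMap.sum_apply, applyOp_tmul,
    diag_pow_deltaPow, pow_val_natCast, ← TensorProduct.smul_tmul', smul_smul]
  rw [sum_comm]
  simp only [← sum_smul]
  rw [sum_congr rfl fun k hk => by rw [sum_inv_pow_mul_pow p q (mem_range.1 hk) hn]]
  simp [ite_smul, hn, smul_smul, hp0]

/-- The coefficient of `δ ^ (n - j + l) ⊗ η₊ ^ l η₋ ^ j δ ^ n` in `T^λ δ ^ n`, apart from the
plane wave. -/
noncomputable def repTCoeff (s lP lM : ℂ) (n l j : ℕ) : ℂ :=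
  (-Complex.I * s⁻¹ * lP * (q ^ j * (q ^ n)⁻¹)) ^ l / qFact q l *
    ((-Complex.I * (s * (q ^ n)⁻¹) * lM) ^ j / qFact q j)

/-- In `T^λ δ ^ n` the Gaussian factors `q ^ (± l (l - 1) / 2)` of the two cut-off exponentials
cancel against those of the powers of `L^λ(ε_±)`. -/
theorem repT_delta_pow (s lP lM : ℂ) {n : ℕ} (hn : n < p) :
    repT p q s lP lM (SO.delta p ^ n) =
      ∑ l ∈ range p, ∑ j ∈ range p, repTCoeff q s lP lM n l j •
        (SO.deltaPow p ((n : ZMod p) - j + l) ⊗ₜ[ℂ]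
          (planeWave p q (lP ^ p) (lM ^ p) *
            (etaP p q ^ l * (etaM p q ^ j * delta p q ^ n)))) := by
  have hq : q ≠ 0 := UE.q_ne_zero (p := p)
  rw [repT, opT, rep_bigPP, rep_bigPM, rep_kappa, opExp_smul_one, cutoffExp_smul_tmul,
    cutoffExp_smul_tmul, SO.delta_pow, mul_assoc, mul_assoc, applyOp_tmul_mul]
  simp only [sum_mul, smul_mul_assoc, map_sum, map_smul, LinearMap.sum_apply,
    LinearMap.smul_apply, applyOp_tmul_mul]
  simp only [applyOp_opD p q hn, TensorProduct.map_tmul, smul_sum, LinearMap.mulLeft_apply,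
    Module.End.one_apply]
  refine sum_congr rfl fun l _ => sum_congr rfl fun j _ => ?_
  rw [weightedShift_pow (rep_epsM_deltaPow s lP lM)]
  simp only [map_smul, smul_smul, ← TensorProduct.smul_tmul']
  rw [weightedShift_pow (rep_epsP_deltaPow s lP lM)]
  simp only [smul_smul, ← TensorProduct.smul_tmul']
  have hidx : (n : ZMod p) + j * -1 + l * 1 = n - j + l := by ring
  have hidx' : (n : ZMod p) + j * -1 = n + -(j : ZMod p) := by ring
  rw [hidx, hidx']
  congr 1
  rw [pow_val_add, pow_val_neg, pow_val_neg, pow_val_natCast, pow_val_natCast, pow_val_one,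
    repTCoeff, one_mul, neg_one_mul, zpow_neg, zpow_natCast, zpow_natCast, inv_inv]
  have e1 : q ^ l.choose 2 * q⁻¹ ^ l.choose 2 = 1 := by
    rw [← mul_pow, mul_inv_cancel₀ hq, one_pow]
  have e2 : (q ^ j.choose 2)⁻¹ * q ^ j.choose 2 = 1 := inv_mul_cancel₀ (pow_ne_zero _ hq)
  have e3 : (-Complex.I * s⁻¹ * lP * (q ^ j * (q ^ n)⁻¹)) ^ l =
      Complex.I ^ l * (-s⁻¹ * lP * (q ^ n * (q ^ j)⁻¹)⁻¹) ^ l := by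
    rw [← mul_pow, mul_inv, inv_inv]
    ring
  have e4 : (-Complex.I * (s * (q ^ n)⁻¹) * lM) ^ j =
      Complex.I ^ j * (-s * lM * (q ^ n)⁻¹) ^ j := by
    rw [← mul_pow]
    ring
  rw [e3, e4]
  generalize (-s⁻¹ * lP * (q ^ n * (q ^ j)⁻¹)⁻¹) ^ l = A
  generalize (-s * lM * (q ^ n)⁻¹) ^ j = B
  linear_combination (Complex.I ^ l * A / qFact q l * Complex.I ^ j * B / qFact q j) *
    (q ^ l.choose 2 * q⁻¹ ^ l.choose 2 * e2 + e1)

end Factors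

/-! ### Matrix elements -/

theorem form_deltaPow (p : ℕ) (a b : ZMod p) :
    SO.form p (SO.deltaPow p a) (SO.deltaPow p b) = if a + b = 0 then 1 else 0 := by
  rw [SO.form, SO.star_deltaPow, SO.deltaPow_mul, SO.integral, ← SO.basis_apply,
    Module.Basis.coord_apply, Module.Basis.repr_self, Finsupp.single_apply]

/-- The form with `δ ^ (p - m) ⊗ 1` picks out of `T^λ δ ^ n` the terms whose power of `δ` in the
first factor is `δ ^ m`, that is, those with `l + n ≡ j + m` modulo `p`. -/
theorem matrixElement_eq_sum (p : ℕ) (q : ℂ) [NeZero p] [Fact (IsPrimitiveRoot q p)]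
    (s lP lM : ℂ) {m n : ℕ} (hm : m ≤ p) (hn : n < p) :
    matrixElement p q s lP lM m n = planeWave p q (lP ^ p) (lM ^ p) *
      ∑ l ∈ range p, ∑ j ∈ range p, if ((l + n : ℕ) : ZMod p) = (j + m : ℕ) then
        repTCoeff q s lP lM n l j • (etaP p q ^ l * (etaM p q ^ j * delta p q ^ n)) else 0 := by
  have hadd : ∀ x (y z : SO p ⊗[ℂ] AE p q), formE p q x (y + z) = formE p q x y + formE p q x z :=
    fun x y z => by simp only [formE, mul_add, map_add]
  have hsmul : ∀ x (c : ℂ) (y : SO p ⊗[ℂ] AE p q), formE p q x (c • y) = c • formE p q x y :=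
    fun x c y => by simp only [formE, mul_smul_comm, map_smul]
  let φ : SO p ⊗[ℂ] AE p q →ₗ[ℂ] AE p q :=
    { toFun := formE p q ((SO.delta p ^ (p - m)) ⊗ₜ[ℂ] 1)
      map_add' := hadd _
      map_smul' := fun c y => hsmul _ c y }
  change φ _ = _
  rw [repT_delta_pow p q s lP lM hn]
  simp only [map_sum, map_smul, mul_sum]
  refine sum_congr rfl fun l _ => sum_congr rfl fun j _ => ?_
  change _ • formE p q _ _ = _
  rw [formE_tmul, SO.delta_pow, form_deltaPow, star_one, one_mul]
  have hiff : ((p - m : ℕ) : ZMod p) + (n - j + l) = 0 ↔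
      ((l + n : ℕ) : ZMod p) = (j + m : ℕ) := by
    rw [Nat.cast_sub hm, ZMod.natCast_self, ← sub_eq_zero (a := ((l + n : ℕ) : ZMod p))]
    push_cast
    ring_nf
  simp only [hiff]
  split_ifs
  · rw [one_smul, mul_smul_comm]
  · simp

/-- The terms of a double sum over `[0, p)²` on the line `j ≡ l + d` modulo `p` form two
segments: `j = l + d`, and `l = j + (p - d)`. -/
theorem sum_sum_ite_natCast_eq {M : Type*} [AddCommMonoid M] {p d : ℕ} [NeZero p] (hd : d ≤ p)
    (f : ℕ → ℕ → M) :
    (∑ l ∈ range p, ∑ j ∈ range p, if ((l + d : ℕ) : ZMod p) = j then f l j else 0) =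
      ∑ k ∈ range (p - d), f k (k + d) + ∑ k ∈ range d, f (k + (p - d)) k := by
  have h1 : ∀ l, (∑ j ∈ range p, if ((l + d : ℕ) : ZMod p) = j then f l j else 0) =
      f l ((l + d) % p) := fun l => by
    rw [sum_eq_single ((l + d) % p)]
    · simp
    · intro j hj hne
      rw [if_neg]
      intro h
      rw [ZMod.natCast_eq_natCast_iff'] at h
      rw [h, Nat.mod_eq_of_lt (mem_range.1 hj)] at hne
      exact hne rfl
    · intro h
      exact absurd (mem_range.2 (Nat.mod_lt _ (NeZero.pos p))) h
  simp only [h1]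
  obtain ⟨e, rfl⟩ := Nat.exists_eq_add_of_le' hd
  rw [Nat.add_sub_cancel, sum_range_add]
  congr 1
  · refine sum_congr rfl fun k hk => ?_
    rw [Nat.mod_eq_of_lt (by have := mem_range.1 hk; omega)]
  · refine sum_congr rfl fun k hk => ?_
    have hk' := mem_range.1 hk
    rw [show e + k + d = k + (e + d) by ring, Nat.add_mod_right, Nat.mod_eq_of_lt (by omega),
      add_comm e k]

section Terms

variable {p : ℕ} {q s : ℂ}

/-- Normal ordering of a term with more factors `η₋` than `η₊`. -/
theorem repTCoeff_smul_of_etaM (hq : q ≠ 0) (hs : s ≠ 0) (lP lM : ℂ) {m n d : ℕ}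
    (hd : q ^ (d + m) = q ^ n) (k : ℕ) :
    repTCoeff q s lP lM n k (k + d) •
        (etaP p q ^ k * (etaM p q ^ (k + d) * delta p q ^ n)) =
      (((-(lP * lM)) ^ k * (q ^ (k * (m + n)))⁻¹ / (qFact q k * qFact q (k + d))) • xi p q ^ k) *
        ((-Complex.I * (s * (q ^ n)⁻¹) * lM) • etaM p q) ^ d * delta p q ^ n := by
  rw [xi_pow, smul_pow, smul_smul, smul_mul_smul_comm, smul_mul_assoc, pow_add]
  simp only [mul_assoc]
  congr 1
  have hI : Complex.I ^ 2 = -1 := Complex.I_sq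
  -- `q ^ ((k + d) k) = q ^ (k²) q ^ (k (n - m))`, whose first factor is that of `ξ ^ k`.
  have e1 : (-Complex.I * s⁻¹ * lP * (q ^ (k + d) * (q ^ n)⁻¹)) ^ k *
      (-Complex.I * (s * (q ^ n)⁻¹) * lM) ^ k =
      (-(lP * lM)) ^ k * (q ^ (k * (m + n)))⁻¹ * q ^ (k * k) := by
    rw [mul_comm k (m + n), pow_mul, pow_mul, ← inv_pow (q ^ (m + n)), ← mul_pow, ← mul_pow,
      ← mul_pow]
    congr 1
    rw [pow_add, pow_add, ← hd, pow_add]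
    field_simp
    rw [hI]
    ring
  rw [repTCoeff, pow_add (-Complex.I * (s * (q ^ n)⁻¹) * lM)]
  linear_combination ((-Complex.I * (s * (q ^ n)⁻¹) * lM) ^ d / (qFact q k * qFact q (k + d))) * e1

/-- Normal ordering of a term with more factors `η₊` than `η₋`. -/
theorem repTCoeff_smul_of_etaP (hq : q ≠ 0) (hs : s ≠ 0) (lP lM : ℂ) {m n d : ℕ}
    (hd : q ^ (d + n) = q ^ m) (k : ℕ) :
    repTCoeff q s lP lM n (k + d) k •
        (etaP p q ^ (k + d) * (etaM p q ^ k * delta p q ^ n)) =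
      ((-Complex.I * (s⁻¹ * (q ^ n)⁻¹) * lP) • etaP p q) ^ d * delta p q ^ n *
        (((-(lP * lM)) ^ k * q ^ (k * (m + n)) / (qFact q k * qFact q (k + d))) • xi p q ^ k) := by
  rw [mul_smul_comm, mul_assoc, delta_pow_mul_xi_pow hq, xi_pow, smul_pow, smul_mul_assoc,
    mul_smul_comm, smul_mul_assoc, mul_smul_comm, smul_smul, smul_smul, smul_smul,
    add_comm k d, pow_add (etaP p q)]
  simp only [mul_assoc]
  congr 1
  have hI : Complex.I ^ 2 = -1 := Complex.I_sq
  -- `(q ^ d) ^ k` comes from the surplus `η₊ ^ d`; on the right, the factor `q ^ (-4 k n)` comes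
  -- from `δ ^ n ξ ^ k = q ^ (-4 k n) ξ ^ k δ ^ n` and `q ^ (k²)` from `ξ ^ k`.
  have e1 : (-Complex.I * s⁻¹ * lP * (q ^ k * (q ^ n)⁻¹)) ^ k *
      (-Complex.I * (s * (q ^ n)⁻¹) * lM) ^ k * (q ^ d) ^ k =
      (-(lP * lM)) ^ k * q ^ (k * (m + n)) * ((q ^ 4) ^ (k * n))⁻¹ * q ^ (k * k) := by
    rw [mul_comm k (m + n), mul_comm k n, pow_mul, pow_mul, pow_mul, ← inv_pow ((q ^ 4) ^ n),
      ← mul_pow, ← mul_pow, ← mul_pow, ← mul_pow, ← mul_pow]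
    congr 1
    rw [pow_add, ← hd, pow_add]
    field_simp
    rw [hI]
    ring
  have e2 : (-Complex.I * s⁻¹ * lP * (q ^ k * (q ^ n)⁻¹)) ^ d =
      (-Complex.I * (s⁻¹ * (q ^ n)⁻¹) * lP) ^ d * (q ^ d) ^ k := by
    rw [← pow_mul, mul_comm d k, pow_mul, ← mul_pow]
    ring
  rw [repTCoeff, pow_add, e2]
  linear_combination ((-Complex.I * (s⁻¹ * (q ^ n)⁻¹) * lP) ^ d /
    (qFact q k * qFact q (d + k))) * e1

end Terms

section MatrixElements

variable (p : ℕ) (q : ℂ) [NeZero p] [h : Fact (IsPrimitiveRoot q p)] {s : ℂ}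

theorem matrixElement_of_le (hs : s ≠ 0) (lP lM : ℂ) {m n : ℕ} (hn : n < p) (hmn : m ≤ n) :
    matrixElement p q s lP lM m n =
      planeWave p q (lP ^ p) (lM ^ p) *
        ((∑ k ∈ range (p - n + m),
            ((-(lP * lM)) ^ k * (q ^ (k * (m + n)))⁻¹ /
              (qFact q k * qFact q (k + (n - m)))) • xi p q ^ k) *
            ((-Complex.I * (s * (q ^ n)⁻¹) * lM) • etaM p q) ^ (n - m) * delta p q ^ n +
          ((-Complex.I * (s⁻¹ * (q ^ n)⁻¹) * lP) • etaP p q) ^ (p + m - n) * delta p q ^ n *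
            ∑ k ∈ range (n - m),
              ((-(lP * lM)) ^ k * q ^ (k * (m + n)) /
                (qFact q k * qFact q (k + (p + m - n)))) • xi p q ^ k) := by
  have hq : q ≠ 0 := UE.q_ne_zero (p := p)
  have hiff : ∀ l j : ℕ, ((l + n : ℕ) : ZMod p) = (j + m : ℕ) ↔
      ((l + (n - m) : ℕ) : ZMod p) = j := fun l j => by
    rw [show l + n = l + (n - m) + m by omega]
    push_cast
    exact add_left_inj _
  rw [matrixElement_eq_sum p q s lP lM (hmn.trans hn.le) hn]
  simp only [hiff]
  rw [sum_sum_ite_natCast_eq (by omega : n - m ≤ p), show p - n + m = p - (n - m) by omega,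
    show p + m - n = p - (n - m) by omega]
  have h1 : q ^ (n - m + m) = q ^ n := by rw [Nat.sub_add_cancel hmn]
  have h2 : q ^ (p - (n - m) + n) = q ^ m := by
    rw [show p - (n - m) + n = p + m by omega, pow_add, h.out.pow_eq_one, one_mul]
  simp only [repTCoeff_smul_of_etaM hq hs lP lM h1, repTCoeff_smul_of_etaP hq hs lP lM h2,
    sum_mul, mul_sum]

theorem matrixElement_of_ge (hs : s ≠ 0) (lP lM : ℂ) {m n : ℕ} (hm : m < p) (hnm : n ≤ m) :
    matrixElement p q s lP lM m n =
      planeWave p q (lP ^ p) (lM ^ p) *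
        ((∑ k ∈ range (m - n),
            ((-(lP * lM)) ^ k * (q ^ (k * (m + n)))⁻¹ /
              (qFact q k * qFact q (k + (p + n - m)))) • xi p q ^ k) *
            ((-Complex.I * (s * (q ^ n)⁻¹) * lM) • etaM p q) ^ (p + n - m) * delta p q ^ n +
          ((-Complex.I * (s⁻¹ * (q ^ n)⁻¹) * lP) • etaP p q) ^ (m - n) * delta p q ^ n *
            ∑ k ∈ range (p - m + n),
              ((-(lP * lM)) ^ k * q ^ (k * (m + n)) /
                (qFact q k * qFact q (k + (m - n)))) • xi p q ^ k) := by
  have hq : q ≠ 0 := UE.q_ne_zero (p := p)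
  have hiff : ∀ l j : ℕ, ((l + n : ℕ) : ZMod p) = (j + m : ℕ) ↔
      ((j + (m - n) : ℕ) : ZMod p) = l := fun l j => by
    rw [show j + m = j + (m - n) + n by omega, eq_comm]
    push_cast
    exact add_left_inj _
  rw [matrixElement_eq_sum p q s lP lM hm.le (hnm.trans_lt hm), sum_comm]
  simp only [hiff]
  rw [sum_sum_ite_natCast_eq (by omega : m - n ≤ p) (fun j l => repTCoeff q s lP lM n l j •
      (etaP p q ^ l * (etaM p q ^ j * delta p q ^ n))), show p - m + n = p - (m - n) by omega,
    show p + n - m = p - (m - n) by omega, add_comm]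
  have h1 : q ^ (p - (m - n) + m) = q ^ n := by
    rw [show p - (m - n) + m = p + n by omega, pow_add, h.out.pow_eq_one, one_mul]
  have h2 : q ^ (m - n + n) = q ^ m := by rw [Nat.sub_add_cancel hnm]
  simp only [repTCoeff_smul_of_etaM hq hs lP lM h1, repTCoeff_smul_of_etaP hq hs lP lM h2,
    sum_mul, mul_sum]

end MatrixElements

theorem cutoffBessel_smul (p : ℕ) (q : ℂ) (m : ℕ) {R : Type*} [Ring R] [Algebra ℂ R]
    (c : ℂ) (x : R) :
    cutoffBessel p q m (c • x) =
      ∑ k ∈ range (p - m), ((-c) ^ k * q ^ (k * m) / (qFact q k * qFact q (k + m))) • x ^ k := by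
  refine sum_congr rfl fun k _ => ?_
  rw [smul_pow, smul_smul, hahnExtonCoeff, neg_pow c, mul_comm k m, pow_mul]
  congr 1
  ring

end QPoincare

theorem proposition2 (p : ℕ) [NeZero p] (hp : Odd p) (hp1 : 1 < p)
    (q s : ℂ) [Fact (IsPrimitiveRoot q p)] (hs : s ^ 2 = q)
    (lP lM : ℝ) (hl : (lP, lM) ≠ (0, 0)) :
    (∀ m n : ℕ, m < p → n < p → m ≤ n →
      matrixElement p q s lP lM m n =
        planeWave p q ((lP : ℂ) ^ p) ((lM : ℂ) ^ p) *
          ((∑ k ∈ Finset.range (p - n + m),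
              ((-((lP : ℂ) * lM)) ^ k * (q ^ (k * (m + n)))⁻¹ /
                (qFact q k * qFact q (k + (n - m)))) • xi p q ^ k) *
              ((-Complex.I * (s * (q ^ n)⁻¹) * lM) • etaM p q) ^ (n - m) * delta p q ^ n +
            ((-Complex.I * (s⁻¹ * (q ^ n)⁻¹) * lP) • etaP p q) ^ (p + m - n) * delta p q ^ n *
              ∑ k ∈ Finset.range (n - m),
                ((-((lP : ℂ) * lM)) ^ k * q ^ (k * (m + n)) /
                  (qFact q k * qFact q (k + (p + m - n)))) • xi p q ^ k)) ∧
    (∀ m n : ℕ, m < p → n < p → n ≤ m →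
      matrixElement p q s lP lM m n =
        planeWave p q ((lP : ℂ) ^ p) ((lM : ℂ) ^ p) *
          ((∑ k ∈ Finset.range (m - n),
              ((-((lP : ℂ) * lM)) ^ k * (q ^ (k * (m + n)))⁻¹ /
                (qFact q k * qFact q (k + (p + n - m)))) • xi p q ^ k) *
              ((-Complex.I * (s * (q ^ n)⁻¹) * lM) • etaM p q) ^ (p + n - m) * delta p q ^ n +
            ((-Complex.I * (s⁻¹ * (q ^ n)⁻¹) * lP) • etaP p q) ^ (m - n) * delta p q ^ n *
              ∑ k ∈ Finset.range (p - m + n),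
                ((-((lP : ℂ) * lM)) ^ k * q ^ (k * (m + n)) /
                  (qFact q k * qFact q (k + (m - n)))) • xi p q ^ k)) ∧
    (∀ m : ℕ, m < p →
      matrixElement p q s lP lM m 0 =
        planeWave p q ((lP : ℂ) ^ p) ((lM : ℂ) ^ p) *
          (cutoffBessel p q (p - m) (((lP : ℂ) * lM) • xi p q) *
              ((-Complex.I * s * lM) • etaM p q) ^ (p - m) +
            ((-Complex.I * s⁻¹ * lP) • etaP p q) ^ m *
              cutoffBessel p q m (((lP : ℂ) * lM) • xi p q))) := by
  have hs0 : s ≠ 0 := by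
    rintro rfl
    exact UE.q_ne_zero (p := p) (q := q) (by rw [← hs]; simp)
  refine ⟨fun m n _ hn hmn => matrixElement_of_le p q hs0 lP lM hn hmn,
    fun m n hm _ hnm => matrixElement_of_ge p q hs0 lP lM hm hnm, fun m hm => ?_⟩
  have hinv : ∀ k : ℕ, q ^ (k * (p - m)) = (q ^ (k * m))⁻¹ := fun k => by
    refine eq_inv_of_mul_eq_one_left ?_
    rw [← pow_add, ← mul_add, Nat.sub_add_cancel hm.le, mul_comm, pow_mul,
      (Fact.out : IsPrimitiveRoot q p).pow_eq_one, one_pow]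
  rw [matrixElement_of_ge p q hs0 lP lM hm m.zero_le, cutoffBessel_smul, cutoffBessel_smul,
    Nat.sub_sub_self hm.le]
  simp only [hinv, add_zero, Nat.sub_zero, pow_zero, inv_one, mul_one]
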